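/- Let $G$ be a finitely generated group and let $p$ be a prime. For a group $H$ and $r\ge 0$ write $b_r(H;\mathbb F_p)=\dim_{\mathbb F_p}H_r(H;\mathbb F_p)$, where $H_r$ is group homology with trivial coefficients. Suppose that $b_2(G;\mathbb F_p)$ is finite. Let $K$ be a finite index normal subgroup of $G$ such that $G/K$ is an elementary abelian $p$-group of rank $n$, i.e. $G/K\cong(\mathbb Z/p)^n$. Then, for every integer $\ell$ with $0\le\ell\le n$, $$b_1(K;\mathbb F_p)\;\ge\;\sum_{r=2}^{\ell+1}\binom nr(r-1)+\bigl(b_1(G;\mathbb F_p)-n\bigr)\sum_{r=0}^{\ell}\binom nr-b_2(G;\mathbb F_p)\sum_{r=0}^{\ell-1}\binom nr .$$ Moreover, if $p=2$, then $$b_1(K;\mathbb F_2)\;\ge\;b_1(G;\mathbb F_2)\sum_{r=0}^{\ell}\binom nr-\sum_{r=1}^{\ell+1}\binom nr-b_2(G;\mathbb F_2)\sum_{r=0}^{\ell-1}\binom nr .$$ Here, for $\ell=0$, the empty sums $\sum_{r=2}^{\ell+1}$ and $\sum_{r=0}^{\ell-1}$ are zero. -/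

import Mathlib

universe u

/-- The field `𝔽_p` with `p` elements, lifted to the universe of the group `G` (the group
homology in Mathlib wants the group and the coefficient ring in the same universe). -/
abbrev LiftedFp (p : ℕ) : Type u := ULift.{u} (ZMod p)

/-- The group homology `H_r(G; 𝔽_p)` with trivial coefficients, a vector space over `𝔽_p`. -/
noncomputable abbrev modPHomology (p : ℕ) (G : Type u) [Group G] (r : ℕ) :
    ModuleCat.{u} (LiftedFp.{u} p) :=
  groupHomology (Rep.trivial (LiftedFp.{u} p) G (LiftedFp.{u} p)) r

/-- The number `b_r(G; 𝔽_p)`: the dimension of `H_r(G; 𝔽_p)` over `𝔽_p`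
(the value is meaningful when this dimension is finite). -/
noncomputable def modPBetti (p : ℕ) (G : Type u) [Group G] (r : ℕ) : ℕ :=
  Module.finrank (LiftedFp.{u} p) (modPHomology p G r)

/-- A group is an elementary abelian `p`-group of rank `n` if it is isomorphic to the
direct product of `n` copies of the cyclic group of order `p`. -/
def IsElementaryAbelianOfRank (p n : ℕ) (H : Type u) [Group H] : Prop :=
  Nonempty (H ≃* Multiplicative (Fin n → ZMod p))

/-!
Write `E = G ⧸ K = 𝔽_p^n` and let `A` be the space of functions `E → 𝔽_p`, on which `G` acts by
translation. By Shapiro's lemma `H_1(K; 𝔽_p) = H_1(G; A)`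
(`nonempty_homology_functionRep_equiv`), so it suffices to bound `H_1(G; A)` from below. This is
done by comparing `A` with a quotient that has a filtration with trivial graded pieces of known
dimensions.

Sending a function to its moments against the squarefree monomials `x_I = ∏_{i ∈ I} x_i` with
`|I| < m` defines a surjection from `A` onto a representation `N_m`. A translation changes a moment
only by moments of lower degree, so there are short exact sequences
`0 → 𝔽_p^(n choose m) → N_(m+1) → N_m → 0` with trivial action on the left. The quantity
`dim H_1 - dim H_0 - dim H_2` is superadditive in short exact sequences, and a finer count at the
last step, which avoids the `H_2` of the top graded piece, gives
`dim H_1(G; N_(ℓ+1)) ≥ 1 + (b_1(G) - 1) ∑_{r ≤ ℓ} (n choose r) - b_2(G) ∑_{r < ℓ} (n choose r)`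
(`le_homDim_one_momentRep_succ`).

Let `J` be the kernel of `A → N_(ℓ+1)`. The sequence `H_1(G; A) → H_1(G; N_(ℓ+1)) → H_0(G; J)` shows
that at most `dim H_0(G; J)` is lost in passing from `N_(ℓ+1)` to `A`. Dually, `H_0(G; J)` is the
space of functions on `E` all of whose differences are squarefree polynomials of degree at most `ℓ`,
modulo such polynomials themselves. These functions are the squarefree polynomials of degree at most
`ℓ + 1`, together with the squares of the coordinates when `p` is odd and `ℓ ≥ 1`; hence
`dim H_0(G; J)` is at most `(n choose ℓ+1)` plus possibly `n`
(`homDim_zero_momentKer_add_card_le`, `eq_zero_of_mem_differencesIn`).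

The resulting inequality (`homDim_one_subgroup_bound`) is the bound for `p = 2`, and it implies the
bound for general `p` by an inequality between binomial sums (`sum_choose_mul_add_sum_choose_le`).
-/

/-! ### Dimension counts along exact sequences -/

section LinearAlgebra

variable {k : Type*} [Field k]

theorem finite_of_range_eq_ker {U V W : Type*} [AddCommGroup U] [Module k U]
    [AddCommGroup V] [Module k V] [AddCommGroup W] [Module k W] [Module.Finite k U]
    [Module.Finite k W] (f : U →ₗ[k] V) (g : V →ₗ[k] W)
    (h : LinearMap.range f = LinearMap.ker g) : Module.Finite k V := by
  refine ⟨Submodule.fg_of_fg_map_of_fg_inf_ker g (IsNoetherian.noetherian _) ?_⟩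
  rw [top_inf_eq, ← h, LinearMap.range_eq_map]
  exact Module.Finite.fg_top.map f

theorem finrank_range_add_finrank_range {U V W : Type*} [AddCommGroup U] [Module k U]
    [AddCommGroup V] [Module k V] [AddCommGroup W] [Module k W] [Module.Finite k V]
    (f : U →ₗ[k] V) (g : V →ₗ[k] W)
    (h : LinearMap.range f = LinearMap.ker g) :
    Module.finrank k (LinearMap.range f) + Module.finrank k (LinearMap.range g) =
      Module.finrank k V := by
  rw [h, add_comm]
  exact LinearMap.finrank_range_add_finrank_ker g

end LinearAlgebra

/-! ### Dimensions in the long exact sequence of group homology -/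

section Homology

open CategoryTheory groupHomology

variable {k G : Type u} [Field k] [Group G]

/-- The dimension of `H_r(G; A)`, with the convention of `finrank` that it is `0` when infinite. -/
noncomputable def homDim (A : Rep.{u} k G) (r : ℕ) : ℕ :=
  Module.finrank k (groupHomology A r)

theorem homDim_zero_le_of_epi {A B : Rep.{u} k G} (f : A ⟶ B) [Epi f]
    [Module.Finite k (groupHomology A 0)] : homDim B 0 ≤ homDim A 0 :=
  LinearMap.finrank_le_finrank_of_surjective (M := groupHomology A 0) (M' := groupHomology B 0)
    (f := ((functor k G 0).map f).hom)
    ((ModuleCat.epi_iff_surjective _).1 (epi_map_0_of_epi f))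

variable {X : ShortComplex (Rep.{u} k G)} (hX : X.ShortExact)
include hX

theorem range_map_eq_ker_map (r : ℕ) :
    LinearMap.range (map (MonoidHom.id G) X.f r).hom =
      LinearMap.ker (map (MonoidHom.id G) X.g r).hom :=
  (ShortComplex.moduleCat_exact_iff_range_eq_ker _).1 (mapShortComplex₂_exact hX r)

theorem range_map_eq_ker_δ (r : ℕ) :
    LinearMap.range (map (MonoidHom.id G) X.g (r + 1)).hom =
      LinearMap.ker (δ hX (r + 1) r rfl).hom :=
  (ShortComplex.moduleCat_exact_iff_range_eq_ker _).1 (mapShortComplex₃_exact hX rfl)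

theorem range_δ_eq_ker_map (r : ℕ) :
    LinearMap.range (δ hX (r + 1) r rfl).hom =
      LinearMap.ker (map (MonoidHom.id G) X.f r).hom :=
  (ShortComplex.moduleCat_exact_iff_range_eq_ker _).1 (mapShortComplex₁_exact hX rfl)

theorem map_zero_surjective :
    Function.Surjective (map (MonoidHom.id G) X.g 0).hom := by
  have := hX.epi_g
  exact (ModuleCat.epi_iff_surjective _).1 (epi_map_0_of_epi X.g)

theorem finite_homology_middle (r : ℕ) [Module.Finite k (groupHomology X.X₁ r)]
    [Module.Finite k (groupHomology X.X₃ r)] : Module.Finite k (groupHomology X.X₂ r) :=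
  finite_of_range_eq_ker _ _ (range_map_eq_ker_map hX r)

/-- Dimension count for the long exact sequence from `H_2` down to `H_0`. The number `c` is the rank
of the connecting map `H_2(X₃) → H_1(X₁)`. -/
theorem homDim_two_and_one_add_zero
    [Module.Finite k (groupHomology X.X₁ 0)] [Module.Finite k (groupHomology X.X₃ 0)]
    [Module.Finite k (groupHomology X.X₁ 1)] [Module.Finite k (groupHomology X.X₃ 1)]
    [Module.Finite k (groupHomology X.X₁ 2)] [Module.Finite k (groupHomology X.X₃ 2)] :
    ∃ c : ℕ, c ≤ homDim X.X₃ 2 ∧ homDim X.X₂ 2 + c ≤ homDim X.X₁ 2 + homDim X.X₃ 2 ∧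
      homDim X.X₂ 1 + homDim X.X₁ 0 + homDim X.X₃ 0 + c =
        homDim X.X₁ 1 + homDim X.X₃ 1 + homDim X.X₂ 0 := by
  have := finite_homology_middle hX 0
  have := finite_homology_middle hX 1
  have := finite_homology_middle hX 2
  have e1 := finrank_range_add_finrank_range _ _ (range_map_eq_ker_map hX 2)
  have e2 := finrank_range_add_finrank_range _ _ (range_map_eq_ker_δ hX 1)
  have e3 := finrank_range_add_finrank_range _ _ (range_δ_eq_ker_map hX 1)
  have e4 := finrank_range_add_finrank_range _ _ (range_map_eq_ker_map hX 1)
  have e5 := finrank_range_add_finrank_range _ _ (range_map_eq_ker_δ hX 0)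
  have e6 := finrank_range_add_finrank_range _ _ (range_δ_eq_ker_map hX 0)
  have e7 := finrank_range_add_finrank_range _ _ (range_map_eq_ker_map hX 0)
  have e8 : Module.finrank k (LinearMap.range (map (MonoidHom.id G) X.g 0).hom) =
      Module.finrank k (groupHomology X.X₃ 0) := by
    rw [LinearMap.range_eq_top.2 (map_zero_surjective hX), finrank_top]
  have e9 := LinearMap.finrank_range_le (map (MonoidHom.id G) X.f 2).hom
  unfold homDim
  change _ = Module.finrank k (groupHomology X.X₃ 1) at e5
  change _ = Module.finrank k (groupHomology X.X₃ 2) at e2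
  change _ + Module.finrank k (LinearMap.range (map (MonoidHom.id G) X.g 1).hom) = _ at e4
  change Module.finrank k (LinearMap.range (map (MonoidHom.id G) X.g 2).hom) + _ = _ at e2
  change Module.finrank k (LinearMap.range (map (MonoidHom.id G) X.g 1).hom) + _ = _ at e5
  change _ = Module.finrank k (groupHomology X.X₂ 2) at e1
  change _ = Module.finrank k (groupHomology X.X₂ 1) at e4
  change _ = Module.finrank k (groupHomology X.X₂ 0) at e7
  refine ⟨Module.finrank k (LinearMap.range (δ hX (1 + 1) 1 rfl).hom), ?_, ?_, ?_⟩ <;> omega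

theorem homDim_one_le [Module.Finite k (groupHomology X.X₁ 0)]
    [Module.Finite k (groupHomology X.X₂ 1)]  [Module.Finite k (groupHomology X.X₃ 1)] :
    homDim X.X₃ 1 ≤ homDim X.X₂ 1 + homDim X.X₁ 0 := by
  have e5 := finrank_range_add_finrank_range _ _ (range_map_eq_ker_δ hX 0)
  have e6 := LinearMap.finrank_range_le (map (MonoidHom.id G) X.g 1).hom
  have e7 := Submodule.finrank_le (LinearMap.range (δ hX (0 + 1) 0 rfl).hom)
  change Module.finrank k (LinearMap.range (map (MonoidHom.id G) X.g 1).hom) + _ =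
    Module.finrank k (groupHomology X.X₃ 1) at e5
  unfold homDim
  omega

end Homology

/-! ### Homology with trivial coefficients -/

/-- A module `M` with maps to and from `N`, indexed by `ι`, that satisfy the identities of the
projections and inclusions of a biproduct is isomorphic to `ι → N`. -/
noncomputable def piEquivOfBiproduct {k M N ι : Type*} [Field k] [AddCommGroup M] [Module k M]
    [AddCommGroup N] [Module k N] [Fintype ι] [DecidableEq ι] (a : ι → M →ₗ[k] N)
    (b : ι → N →ₗ[k] M) (hab : ∀ i j x, a j (b i x) = if i = j then x else 0)
    (hba : ∀ x, ∑ i, b i (a i x) = x) : M ≃ₗ[k] (ι → N) :=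
  LinearEquiv.ofLinearMap (LinearMap.pi a) (LinearMap.lsum k _ k b)
    (LinearMap.ext fun x => funext fun j => by simp [LinearMap.lsum_apply, hab])
    (LinearMap.ext fun x => by simp [LinearMap.lsum_apply, hba])

/-- The `ℤ`-module structure here is the one of an additive group, which is only propositionally
equal to the one on a tensor product that `Module.Finite.tensorProduct` speaks of. -/
theorem finite_int_tensorProduct (A B : Type*) [AddCommGroup A] [AddCommGroup B]
    [Module.Finite ℤ A] [Finite B] : Module.Finite ℤ (TensorProduct ℤ A B) := by
  have : Module.Finite ℤ B := Module.Finite.of_finite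
  have h := Module.Finite.tensorProduct (R := ℤ) (M := A) (N := B)
  convert h
  · rfl
  · exact Subsingleton.elim (α := Module ℤ (TensorProduct ℤ A B)) _ _

section Homology

open CategoryTheory groupHomology

variable {k G : Type u} [Field k] [Group G]

/-- Exactness of a sequence of representations may be tested on the underlying vector spaces. -/
theorem shortExact_of_range_eq_ker {A B C : Rep.{u} k G} (f : A ⟶ B) (g : B ⟶ C)
    (hf : Function.Injective f.hom) (hg : Function.Surjective g.hom)
    (h : LinearMap.range f.hom.toLinearMap = LinearMap.ker g.hom.toLinearMap) :
    ∃ w : f ≫ g = 0, (ShortComplex.mk f g w).ShortExact := by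
  have w : f ≫ g = 0 := by
    ext x
    exact (h ▸ LinearMap.mem_range_self f.hom.toLinearMap x :
      f.hom.toLinearMap x ∈ LinearMap.ker g.hom.toLinearMap)
  have hm : Mono f := (Rep.mono_iff_injective _).2 hf
  have he : Epi g := (Rep.epi_iff_surjective _).2 hg
  refine ⟨w, { exact := ?_, mono_f := hm, epi_g := he }⟩
  exact (ShortComplex.exact_map_iff_of_faithful _ (forget₂ (Rep.{u} k G) (ModuleCat.{u} k))).1
    ((ShortComplex.moduleCat_exact_iff_range_eq_ker _).2 h)

instance functor_additive (r : ℕ) : (functor k G r).Additive where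
  map_add {A B f g} := by
    have h : (chainsFunctor k G).map (f + g) =
        (chainsFunctor k G).map f + (chainsFunctor k G).map g := by
      refine HomologicalComplex.hom_ext _ _ fun i => ModuleCat.hom_ext ?_
      rw [HomologicalComplex.add_f_apply, ModuleCat.hom_add]
      change ((chainsMap (MonoidHom.id G) (f + g)).f i).hom =
        ((chainsMap (MonoidHom.id G) f).f i).hom + ((chainsMap (MonoidHom.id G) g).f i).hom
      rw [chainsMap_id_f_hom_eq_mapRange, chainsMap_id_f_hom_eq_mapRange,
        chainsMap_id_f_hom_eq_mapRange]
      refine LinearMap.ext fun x => Finsupp.ext fun a => ?_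
      rfl
    exact (congrArg (fun φ => HomologicalComplex.homologyMap φ r) h).trans
      (HomologicalComplex.homologyMap_add _ _ r)

/-- The `i`-th coordinate, as a map of trivial representations. -/
noncomputable def trivialProj (k G : Type u) [Field k] [Group G] (ι : Type) (i : ι) :
    Rep.trivial k G (ι → k) ⟶ Rep.trivial k G k :=
  Rep.ofHom ⟨LinearMap.proj i, fun _ => rfl⟩

/-- The inclusion of the `i`-th coordinate line, as a map of trivial representations. -/
noncomputable def trivialSingle (k G : Type u) [Field k] [Group G] (ι : Type) [DecidableEq ι]
    (i : ι) : Rep.trivial k G k ⟶ Rep.trivial k G (ι → k) :=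
  Rep.ofHom ⟨LinearMap.single k (fun _ => k) i, fun _ => rfl⟩

theorem trivialSingle_comp_trivialProj (ι : Type) [DecidableEq ι] (i j : ι) :
    trivialSingle k G ι i ≫ trivialProj k G ι j = if i = j then 𝟙 _ else 0 := by
  refine Rep.hom_ext (Representation.IntertwiningMap.ext (LinearMap.ext fun x => ?_))
  change Pi.single (M := fun _ => k) i x j = _
  by_cases h : i = j
  · subst h
    simp
  · rw [if_neg h, Pi.single_eq_of_ne' h]
    rfl

theorem sum_trivialProj_comp_trivialSingle (ι : Type) [Fintype ι] [DecidableEq ι] :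
    ∑ i, trivialProj k G ι i ≫ trivialSingle k G ι i = 𝟙 _ := by
  refine Rep.hom_ext (DFunLike.ext _ _ fun x => ?_)
  rw [Rep.sum_hom, Representation.IntertwiningMap.sum_apply]
  change ∑ i, Pi.single i (x i) = x
  exact Finset.univ_sum_single x

/-- Homology of a finite power of the trivial representation: `H_r(G; k^ι) = H_r(G; k)^ι`. -/
noncomputable def homologyTrivialPiEquiv (k G : Type u) [Field k] [Group G] (ι : Type) [Fintype ι]
    [DecidableEq ι] (r : ℕ) :
    groupHomology (Rep.trivial k G (ι → k)) r ≃ₗ[k]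
      (ι → groupHomology (Rep.trivial k G k) r) :=
  piEquivOfBiproduct (fun i => (map (MonoidHom.id G) (trivialProj k G ι i) r).hom)
    (fun i => (map (MonoidHom.id G) (trivialSingle k G ι i) r).hom)
    (fun i j x => by
      have h := congrArg (fun φ => ((functor k G r).map φ).hom x)
        (trivialSingle_comp_trivialProj (k := k) (G := G) ι i j)
      simp only [Functor.map_comp] at h
      refine h.trans ?_
      by_cases hij : i = j
      · rw [if_pos hij, if_pos hij]
        exact congrArg (fun φ => φ.hom x) ((functor k G r).map_id _)
      · rw [if_neg hij, if_neg hij, Functor.map_zero]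
        rfl)
    (fun x => by
      have h := congrArg (fun φ => ((functor k G r).map φ).hom x)
        (sum_trivialProj_comp_trivialSingle (k := k) (G := G) ι)
      simp only [Functor.map_sum, Functor.map_comp, ModuleCat.hom_sum] at h
      exact (LinearMap.sum_apply _ _ _).symm.trans
        (h.trans (congrArg (fun φ => φ.hom x) ((functor k G r).map_id _))))

theorem homDim_trivial_pi (ι : Type) [Fintype ι] (r : ℕ)
    [Module.Finite k (groupHomology (Rep.trivial k G k) r)] :
    homDim (Rep.trivial k G (ι → k)) r = Fintype.card ι * homDim (Rep.trivial k G k) r := by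
  classical
  unfold homDim
  rw [(homologyTrivialPiEquiv k G ι r).finrank_eq, Module.finrank_pi_fintype]
  simp

theorem finite_homology_trivial_pi (ι : Type) [Fintype ι] (r : ℕ)
    [Module.Finite k (groupHomology (Rep.trivial k G k) r)] :
    Module.Finite k (groupHomology (Rep.trivial k G (ι → k)) r) := by
  classical
  exact Module.Finite.equiv (homologyTrivialPiEquiv k G ι r).symm

theorem finite_homology_zero (A : Rep.{u} k G) [Module.Finite k A] :
    Module.Finite k (groupHomology A 0) :=
  Module.Finite.equiv (M := A.ρ.Coinvariants) (H0Iso A).toLinearEquiv.symm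

theorem homDim_zero_eq (A : Rep.{u} k G) :
    homDim A 0 = Module.finrank k A.ρ.Coinvariants :=
  (H0Iso A).toLinearEquiv.finrank_eq

theorem homDim_trivial_zero : homDim (Rep.trivial k G k) 0 = 1 :=
  (H0IsoOfIsTrivial (Rep.trivial k G k)).toLinearEquiv.finrank_eq.trans (Module.finrank_self k)

/-- For a finitely generated group, `H_1(G; k) = Gᵃᵇ ⊗ k` is finite-dimensional. -/
theorem finite_homology_one [Group.FG G] [Finite k] :
    Module.Finite k (groupHomology (Rep.trivial k G k) 1) := by
  have : Group.FG (Abelianization G) :=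
    Group.fg_of_surjective (f := Abelianization.of (G := G)) (QuotientGroup.mk_surjective)
  have h1 : Module.Finite ℤ (Additive (Abelianization G)) :=
    Module.Finite.iff_addGroup_fg.2 inferInstance
  have h2 : Finite (Rep.trivial k G k) := inferInstanceAs (Finite k)
  have h2' := finite_int_tensorProduct (Additive (Abelianization G)) (Rep.trivial k G k)
  have h3 : Module.Finite ℤ (groupHomology (Rep.trivial k G k) 1) :=
    Module.Finite.equiv (H1AddEquivOfIsTrivial (Rep.trivial k G k)).symm.toIntLinearEquiv
  exact Module.Finite.of_restrictScalars_finite ℤ k _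

theorem homDim_zeroModule (A : Rep.{u} k G) [Subsingleton A] (r : ℕ) :
    homDim A r = 0 ∧ Module.Finite k (groupHomology A r) := by
  have : 𝟙 A = 0 := by ext x; exact Subsingleton.elim _ _
  have h : Subsingleton (groupHomology A r) := by
    have := congrArg (fun φ => map (MonoidHom.id G) φ r) this
    have h0 : map (MonoidHom.id G) (0 : A ⟶ A) r = 0 := (functor k G r).map_zero A A
    simp only [map_id, h0] at this
    refine ⟨fun x y => ?_⟩
    have hx := congrArg (fun φ => ModuleCat.Hom.hom φ x) this
    have hy := congrArg (fun φ => ModuleCat.Hom.hom φ y) this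
    simpa using hx.trans hy.symm
  exact ⟨Module.finrank_zero_of_subsingleton, inferInstance⟩

end Homology

/-! ### Squarefree polynomial functions -/

section SquareFree

variable {k : Type u} [Field k] {ι : Type}

/-- Translation by `a` on functions `(ι → k) → k`: it sends `f` to `e ↦ f (e + a)`. -/
noncomputable def shift (k : Type u) [Field k] (ι : Type) (a : ι → k) :
    ((ι → k) → k) →ₗ[k] ((ι → k) → k) :=
  LinearMap.funLeft k k fun e => e + a

@[simp]
theorem shift_apply (a : ι → k) (f : (ι → k) → k) (e : ι → k) :
    shift k ι a f e = f (e + a) := rfl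

/-- The functions all of whose differences `f (· + a) - f` lie in `M`. Modulo `M` (when `M` is
translation invariant) these are the translation invariants of the quotient by `M`. -/
noncomputable def differencesIn (M : Submodule k ((ι → k) → k)) : Submodule k ((ι → k) → k) :=
  ⨅ a : ι → k, M.comap (shift k ι a - LinearMap.id)

theorem mem_differencesIn {M : Submodule k ((ι → k) → k)} {f : (ι → k) → k} :
    f ∈ differencesIn M ↔ ∀ a, shift k ι a f - f ∈ M := by
  simp [differencesIn, Submodule.mem_iInf]

variable [DecidableEq ι]

/-- The 0-1 vector of `S`, a point of `ι → k`. -/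
def indicatorPoint (k : Type u) [Field k] {ι : Type} [DecidableEq ι] (S : Finset ι) : ι → k :=
  fun i => if i ∈ S then 1 else 0

theorem indicatorPoint_empty : indicatorPoint k (∅ : Finset ι) = 0 := by
  funext j
  simp [indicatorPoint]

theorem indicatorPoint_insert {S : Finset ι} {i : ι} (hi : i ∉ S) :
    indicatorPoint k (insert i S) = indicatorPoint k S + Pi.single i 1 := by
  funext j
  by_cases hj : j = i
  · subst hj
    simp [indicatorPoint, hi]
  · simp [indicatorPoint, hj]

variable [Fintype ι]

/-- The polynomial function `∑ c_I x_I` on `ι → k`, where `x_I = ∏_{i ∈ I} x_i` and `I` runs over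
the subsets of `ι` with fewer than `m` elements. -/
noncomputable def squareFreePoly (k : Type u) [Field k] (ι : Type) [Fintype ι] (m : ℕ) :
    ({I : Finset ι // I.card < m} → k) →ₗ[k] ((ι → k) → k) where
  toFun c e := ∑ I, c I * ∏ i ∈ I.1, e i
  map_add' c d := by
    ext e
    simp [add_mul, Finset.sum_add_distrib]
  map_smul' a c := by
    ext e
    simp [Finset.mul_sum, mul_assoc]

theorem squareFreePoly_indicatorPoint (m : ℕ) (c : {I : Finset ι // I.card < m} → k)
    (S : Finset ι) :
    squareFreePoly k ι m c (indicatorPoint k S) = ∑ I with I.1 ⊆ S, c I := by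
  simp only [squareFreePoly, LinearMap.coe_mk, AddHom.coe_mk, indicatorPoint, Finset.prod_boole,
    Finset.sum_filter, mul_ite, mul_one, mul_zero]
  exact Finset.sum_congr rfl fun I _ => if_congr Iff.rfl rfl rfl

/-- A squarefree polynomial of degree less than `m` is determined by its values at 0-1 vectors with
fewer than `m` ones, since the matrix of these values is unitriangular for inclusion. -/
theorem eq_zero_of_squareFreePoly_indicatorPoint (m : ℕ) (c : {I : Finset ι // I.card < m} → k)
    (h : ∀ S : Finset ι, S.card < m → squareFreePoly k ι m c (indicatorPoint k S) = 0) :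
    c = 0 := by
  have key : ∀ S : Finset ι, ∀ hS : S.card < m, c ⟨S, hS⟩ = 0 := by
    intro S
    induction S using Finset.strongInduction with
    | H S ih =>
      intro hS
      have h1 := h S hS
      rw [squareFreePoly_indicatorPoint, Finset.sum_eq_single ⟨S, hS⟩] at h1
      · exact h1
      · intro I hI hne
        refine ih I.1 (Finset.ssubset_iff_subset_ne.2 ⟨(Finset.mem_filter.1 hI).2, ?_⟩) I.2
        exact fun h2 => hne (Subtype.ext h2)
      · intro hn
        simp at hn
  exact funext fun I => key I.1 I.2

theorem squareFreePoly_injective (m : ℕ) : Function.Injective (squareFreePoly k ι m) := by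
  rw [← LinearMap.ker_eq_bot, LinearMap.ker_eq_bot']
  intro c hc
  exact eq_zero_of_squareFreePoly_indicatorPoint m c fun S _ => by rw [hc]; rfl

/-- Squarefree polynomials are affine in every coordinate: their second differences vanish. -/
theorem squareFreePoly_add_single_add_single (m : ℕ) (c : {I : Finset ι // I.card < m} → k)
    (e : ι → k) (i : ι) :
    squareFreePoly k ι m c (e + Pi.single i 1 + Pi.single i 1) + squareFreePoly k ι m c e =
      2 * squareFreePoly k ι m c (e + Pi.single i 1) := by
  simp only [squareFreePoly, LinearMap.coe_mk, AddHom.coe_mk]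
  rw [← Finset.sum_add_distrib, Finset.mul_sum]
  refine Finset.sum_congr rfl fun I _ => ?_
  by_cases hi : i ∈ I.1
  · have h : ∀ f : ι → k, ∏ j ∈ I.1, f j = f i * ∏ j ∈ I.1.erase i, f j := fun f =>
      (Finset.mul_prod_erase _ _ hi).symm
    have h2 : ∀ f : ι → k, ∏ j ∈ I.1.erase i, (f + Pi.single i (1 : k) : ι → k) j =
        ∏ j ∈ I.1.erase i, f j :=
      fun f => Finset.prod_congr rfl fun j hj => by
        rw [Pi.add_apply, Pi.single_eq_of_ne (Finset.ne_of_mem_erase hj), add_zero]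
    rw [h (e + Pi.single i 1 + Pi.single i 1), h e, h (e + Pi.single i 1), h2, h2]
    simp only [Pi.add_apply, Pi.single_eq_same]
    ring
  · have h2 : ∀ f : ι → k, ∏ j ∈ I.1, (f + Pi.single i (1 : k) : ι → k) j = ∏ j ∈ I.1, f j :=
      fun f => Finset.prod_congr rfl fun j hj => by
        rw [Pi.add_apply, Pi.single_eq_of_ne (by rintro rfl; exact hi hj), add_zero]
    rw [h2, h2]
    ring

/-- A function whose differences are squarefree of degree less than `m` is determined by its values
at the 0-1 vectors with at most `m` ones and at the points `2 e_i`. The latter are needed because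
the square of a coordinate has squarefree differences, of degree 1, so for `m ≤ 1` they can be left
out. The hypothesis `hk` says that `k` is a prime field, so that the `e_i` generate `ι → k`. -/
theorem eq_zero_of_mem_differencesIn (hk : ∀ c : k, ∃ m : ℕ, (m : k) = c) (m : ℕ)
    (f : (ι → k) → k) (hf : f ∈ differencesIn (LinearMap.range (squareFreePoly k ι m)))
    (h0 : ∀ S : Finset ι, S.card < m + 1 → f (indicatorPoint k S) = 0)
    (h2 : m ≤ 1 ∨ ∀ i, f (Pi.single i 1 + Pi.single i 1) = 0) : f = 0 := by
  rw [mem_differencesIn] at hf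
  choose c hc using fun i => LinearMap.mem_range.1 (hf (Pi.single i 1))
  have hg : ∀ i e, squareFreePoly k ι m (c i) e = f (e + Pi.single i 1) - f e := fun i e => by
    rw [hc]
    rfl
  -- For `i ∉ S`, the value at `1_S + 2 e_i` does not change when `j` is added to `S`: the
  -- difference of `f` in direction `j` is affine in coordinate `i`, and vanishes at `1_S` and at
  -- `1_S + e_i`. So it equals the value at `2 e_i`.
  have key : (∀ i, f (Pi.single i 1 + Pi.single i 1) = 0) → ∀ i, ∀ S : Finset ι, i ∉ S →
      S.card + 1 < m → f (indicatorPoint k S + Pi.single i 1 + Pi.single i 1) = 0 := by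
    intro h2 i S
    induction S using Finset.induction_on with
    | empty =>
      intro _ _
      rw [indicatorPoint_empty, zero_add, h2]
    | insert j S hj ih =>
      intro hi hcard
      rw [Finset.card_insert_of_notMem hj] at hcard
      rw [Finset.mem_insert, not_or] at hi
      have e1 := squareFreePoly_add_single_add_single m (c j) (indicatorPoint k S) i
      have e2 := ih hi.2 (by omega)
      have e3 : ∀ T : Finset ι, j ∉ T → T.card < m →
          squareFreePoly k ι m (c j) (indicatorPoint k T) = 0 := fun T hT hT' => by
        rw [hg, ← indicatorPoint_insert hT,
          h0 (insert j T) (by rw [Finset.card_insert_of_notMem hT]; omega),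
          h0 T (by omega), sub_zero]
      have e4 := e3 S hj (by omega)
      have e5 := e3 (insert i S) (by simp [hj, Ne.symm hi.1])
        (by rw [Finset.card_insert_of_notMem hi.2]; omega)
      rw [indicatorPoint_insert hi.2] at e5
      rw [e4, e5, hg, e2] at e1
      rw [indicatorPoint_insert hj, add_right_comm _ (Pi.single j 1),
        add_right_comm _ (Pi.single j 1)]
      simpa using e1
  -- All differences of `f` vanish at the 0-1 vectors with fewer than `m` ones, so they are zero.
  have hc0 : ∀ i, c i = 0 := by
    intro i
    refine eq_zero_of_squareFreePoly_indicatorPoint m (c i) fun S hS => ?_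
    rw [hg, h0 S (by omega), sub_zero]
    by_cases hi : i ∈ S
    · have hS' : (S.erase i).card + 1 = S.card := Finset.card_erase_add_one hi
      rcases h2 with h2 | h2
      · omega
      · have := key h2 i (S.erase i) (Finset.notMem_erase i S) (by omega)
        rwa [← indicatorPoint_insert (Finset.notMem_erase i S), Finset.insert_erase hi] at this
    · rw [← indicatorPoint_insert hi, h0 _ (by rw [Finset.card_insert_of_notMem hi]; omega)]
  -- Hence `f` is invariant under all translations, and it vanishes at the origin.
  have hinv : ∀ i e, f (e + Pi.single i 1) = f e := fun i e => by
    have := hg i e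
    rw [hc0, map_zero] at this
    exact sub_eq_zero.1 this.symm
  have hinv2 : ∀ i (q : ℕ) e, f (e + Pi.single i (q : k)) = f e := by
    intro i q
    induction q with
    | zero => simp
    | succ q ih =>
      intro e
      rw [Nat.cast_succ, Pi.single_add, ← add_assoc, hinv, ih]
  have hinv3 : ∀ (s : Finset ι) (e a : ι → k), f (e + ∑ i ∈ s, Pi.single i (a i)) = f e := by
    intro s
    induction s using Finset.induction_on with
    | empty => simp
    | insert i s hi ih =>
      intro e a
      obtain ⟨q, hq⟩ := hk (a i)
      rw [Finset.sum_insert hi, ← add_assoc, ih, ← hq, hinv2]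
  funext e
  have h3 := hinv3 Finset.univ 0 e
  rw [Finset.univ_sum_single, zero_add] at h3
  rw [h3]
  have := h0 ∅ (by simp)
  rwa [indicatorPoint_empty] at this

/-- If `m ≤ 1`, or if `k` has characteristic 2 so that `2 e_i = 0`, the points `2 e_i` impose no
condition. -/
theorem finrank_differencesIn_le_of [Finite k] (hk : ∀ c : k, ∃ m : ℕ, (m : k) = c) (m : ℕ)
    (h : m ≤ 1 ∨ (2 : k) = 0) :
    Module.finrank k (differencesIn (LinearMap.range (squareFreePoly k ι m))) ≤
      Fintype.card {S : Finset ι // S.card < m + 1} := by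
  let ev : differencesIn (LinearMap.range (squareFreePoly k ι m)) →ₗ[k]
      ({S : Finset ι // S.card < m + 1} → k) :=
    LinearMap.pi fun S => LinearMap.proj (indicatorPoint k S.1) ∘ₗ Submodule.subtype _
  have hinj : Function.Injective ev := by
    rw [← LinearMap.ker_eq_bot, LinearMap.ker_eq_bot']
    intro f hf
    have hf' : ∀ S : Finset ι, S.card < m + 1 → f.1 (indicatorPoint k S) = 0 :=
      fun S hS => congrFun hf ⟨S, hS⟩
    refine Subtype.ext (eq_zero_of_mem_differencesIn hk m f.1 f.2 hf' (h.imp id fun h2 i => ?_))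
    rw [← Pi.single_add, one_add_one_eq_two, h2, Pi.single_zero, ← indicatorPoint_empty]
    exact hf' ∅ (by simp)
  simpa using LinearMap.finrank_le_finrank_of_injective hinj

theorem finrank_differencesIn_le [Finite k] (hk : ∀ c : k, ∃ m : ℕ, (m : k) = c) (m : ℕ) :
    Module.finrank k (differencesIn (LinearMap.range (squareFreePoly k ι m))) ≤
      Fintype.card {S : Finset ι // S.card < m + 1} + Fintype.card ι := by
  let ev : differencesIn (LinearMap.range (squareFreePoly k ι m)) →ₗ[k]
      ({S : Finset ι // S.card < m + 1} → k) × (ι → k) :=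
    (LinearMap.pi fun S => LinearMap.proj (indicatorPoint k S.1) ∘ₗ Submodule.subtype _).prod
      (LinearMap.pi fun i => LinearMap.proj (Pi.single i 1 + Pi.single i 1) ∘ₗ Submodule.subtype _)
  have hinj : Function.Injective ev := by
    rw [← LinearMap.ker_eq_bot, LinearMap.ker_eq_bot']
    intro f hf
    have hf' := Prod.ext_iff.1 hf
    exact Subtype.ext (eq_zero_of_mem_differencesIn hk m f.1 f.2
      (fun S hS => congrFun hf'.1 ⟨S, hS⟩) (Or.inr fun i => congrFun hf'.2 i))
  simpa using LinearMap.finrank_le_finrank_of_injective hinj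

end SquareFree

/-! ### Moments of functions against squarefree monomials -/

section Moments

variable {k : Type u} [Field k] [Fintype k] {ι : Type} [Fintype ι] [DecidableEq ι]

/-- The moments `∑_e f(e) x_I(e)` of a function `f` against the squarefree monomials `x_I` of degree
less than `m`. This is the transpose of `squareFreePoly`. -/
noncomputable def moments (k : Type u) [Field k] [Fintype k] (ι : Type) [Fintype ι]
    [DecidableEq ι] (m : ℕ) :
    ((ι → k) → k) →ₗ[k] ({I : Finset ι // I.card < m} → k) where
  toFun f I := ∑ e, f e * ∏ i ∈ I.1, e i
  map_add' f g := by
    ext I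
    simp [add_mul, Finset.sum_add_distrib]
  map_smul' a f := by
    ext I
    simp [Finset.mul_sum, mul_assoc]

theorem moments_apply (m : ℕ) (f : (ι → k) → k) (I : {I : Finset ι // I.card < m}) :
    moments k ι m f I = ∑ e, f e * ∏ i ∈ I.1, e i := rfl

theorem sum_mul_moments (m : ℕ) (f : (ι → k) → k) (c : {I : Finset ι // I.card < m} → k) :
    ∑ I, c I * moments k ι m f I = ∑ e, f e * squareFreePoly k ι m c e := by
  simp only [moments_apply, squareFreePoly, LinearMap.coe_mk, AddHom.coe_mk, Finset.mul_sum]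
  rw [Finset.sum_comm]
  exact Finset.sum_congr rfl fun e _ => Finset.sum_congr rfl fun I _ => by ring

/-- Moments of a translate, by expanding `x_I(e - a)`: the `I`-th moment changes by a combination of
the moments at proper subsets of `I`. -/
theorem moments_shift (m : ℕ) (a : ι → k) (f : (ι → k) → k)
    (I : {I : Finset ι // I.card < m}) :
    moments k ι m (shift k ι a f) I =
      ∑ S ∈ I.1.powerset, (∏ i ∈ I.1 \ S, -a i) * ∑ e, f e * ∏ i ∈ S, e i := by
  rw [moments_apply]
  have h1 : ∑ e, shift k ι a f e * ∏ i ∈ I.1, e i = ∑ e, f e * ∏ i ∈ I.1, (e i + -a i) := by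
    refine Fintype.sum_equiv (Equiv.addRight a) _ _ fun e => ?_
    simp
  rw [h1]
  simp only [Finset.prod_add, Finset.mul_sum]
  rw [Finset.sum_comm]
  exact Finset.sum_congr rfl fun S _ => Finset.sum_congr rfl fun e _ => by ring

theorem moments_shift_eq_zero (m : ℕ) (a : ι → k) (f : (ι → k) → k)
    (hf : moments k ι m f = 0) : moments k ι m (shift k ι a f) = 0 := by
  funext I
  rw [moments_shift]
  refine Finset.sum_eq_zero fun S hS => ?_
  have := congrFun hf
    ⟨S, (Finset.card_le_card (Finset.mem_powerset.1 hS)).trans_lt I.2⟩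
  rw [moments_apply] at this
  rw [this, Pi.zero_apply, mul_zero]

theorem moments_shift_apply_eq (m : ℕ) (a : ι → k) (f : (ι → k) → k)
    (I : {I : Finset ι // I.card < m})
    (hf : ∀ S : {S : Finset ι // S.card < m}, S.1 ⊂ I.1 → moments k ι m f S = 0) :
    moments k ι m (shift k ι a f) I = moments k ι m f I := by
  rw [moments_shift, Finset.sum_eq_single I.1]
  · simp [moments_apply]
  · intro S hS hne
    have hS' := Finset.mem_powerset.1 hS
    have := hf ⟨S, (Finset.card_le_card hS').trans_lt I.2⟩
      (Finset.ssubset_iff_subset_ne.2 ⟨hS', hne⟩)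
    rw [moments_apply] at this
    rw [this, mul_zero]
  · intro h
    simp at h

theorem dual_comp_moments (m : ℕ) (l : Module.Dual k ({I : Finset ι // I.card < m} → k)) (f) :
    l (moments k ι m f) =
      ∑ e, f e * squareFreePoly k ι m (fun I => l (Pi.single I 1)) e := by
  rw [← sum_mul_moments]
  conv_lhs => rw [← Finset.univ_sum_single (moments k ι m f)]
  rw [map_sum]
  refine Finset.sum_congr rfl fun I _ => ?_
  have : Pi.single (M := fun _ => k) I (moments k ι m f I) =
      moments k ι m f I • Pi.single I 1 := by
    rw [← Pi.single_smul, smul_eq_mul, mul_one]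
  rw [this, map_smul, smul_eq_mul, mul_comm]

theorem sum_single_mul (e : ι → k) (h : (ι → k) → k) [DecidableEq (ι → k)] :
    ∑ e', (Pi.single e 1 : (ι → k) → k) e' * h e' = h e := by
  simp [Pi.single_apply]

/-- By duality from the linear independence of the squarefree monomials. -/
theorem moments_surjective (m : ℕ) : Function.Surjective (moments k ι m) := by
  classical
  rw [← LinearMap.dualMap_injective_iff, ← LinearMap.ker_eq_bot, LinearMap.ker_eq_bot']
  intro l hl
  have h0 : (fun I => l (Pi.single I 1)) = (0 : {I : Finset ι // I.card < m} → k) := by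
    refine squareFreePoly_injective m ?_
    rw [map_zero]
    funext e
    have h1 := dual_comp_moments m l (Pi.single e 1)
    rw [sum_single_mul] at h1
    rw [← h1]
    exact DFunLike.congr_fun hl _
  refine LinearMap.pi_ext' fun I => LinearMap.ext_ring ?_
  exact congrFun h0 I

/-- A function orthogonal to the kernel of `moments m` is a squarefree polynomial. -/
theorem mem_range_squareFreePoly_of_ker (m : ℕ) (h : (ι → k) → k)
    (hh : ∀ f, moments k ι m f = 0 → ∑ e, f e * h e = 0) :
    h ∈ LinearMap.range (squareFreePoly k ι m) := by
  classical
  let L : Module.Dual k ((ι → k) → k) :=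
    { toFun := fun f => ∑ e, f e * h e
      map_add' := fun f g => by simp [add_mul, Finset.sum_add_distrib]
      map_smul' := fun a f => by simp [Finset.mul_sum, mul_assoc] }
  have hL : L ∈ LinearMap.range (moments k ι m).dualMap := by
    rw [LinearMap.range_dualMap_eq_dualAnnihilator_ker, Submodule.mem_dualAnnihilator]
    exact fun f hf => hh f hf
  obtain ⟨l, hl⟩ := hL
  refine ⟨fun I => l (Pi.single I 1), funext fun e => ?_⟩
  have h1 := dual_comp_moments m l (Pi.single e 1)
  rw [sum_single_mul] at h1
  rw [← h1]
  exact (DFunLike.congr_fun hl _).trans (sum_single_mul e h)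

theorem sum_mul_squareFreePoly_of_moments_eq_zero (m : ℕ) (f : (ι → k) → k)
    (hf : moments k ι m f = 0) {h : (ι → k) → k}
    (hh : h ∈ LinearMap.range (squareFreePoly k ι m)) : ∑ e, f e * h e = 0 := by
  obtain ⟨c, rfl⟩ := hh
  rw [← sum_mul_moments, hf]
  simp

end Moments

/-! ### The moment representations -/

section Representations

variable {k G : Type u} [Field k] [Group G]

theorem apply_surjInv_of_ker_le {V W : Type*} [AddCommGroup V] [Module k V] [AddCommGroup W]
    [Module k W] (T : V →ₗ[k] W) (hT : Function.Surjective T) (f : V →ₗ[k] V)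
    (hf : ∀ v, T v = 0 → T (f v) = 0) (v : V) :
    T (f (Function.surjInv hT (T v))) = T (f v) := by
  rw [← sub_eq_zero, ← map_sub, ← map_sub]
  refine hf _ ?_
  rw [map_sub, Function.surjInv_eq hT, sub_self]

/-- The representation on `W` induced by a representation on `V` along a surjection `T : V → W` with
invariant kernel. -/
noncomputable def descendRep {V W : Type*} [AddCommGroup V] [Module k V] [AddCommGroup W]
    [Module k W] (ρ : Representation k G V) (T : V →ₗ[k] W) (hT : Function.Surjective T)
    (hρ : ∀ g v, T v = 0 → T (ρ g v) = 0) : Representation k G W where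
  toFun g :=
    { toFun := fun w => T (ρ g (Function.surjInv hT w))
      map_add' := fun x y => by
        obtain ⟨x, rfl⟩ := hT x
        obtain ⟨y, rfl⟩ := hT y
        simp only [← map_add, apply_surjInv_of_ker_le T hT (ρ g) (hρ g)]
      map_smul' := fun a x => by
        obtain ⟨x, rfl⟩ := hT x
        simp only [← map_smul, apply_surjInv_of_ker_le T hT (ρ g) (hρ g), RingHom.id_apply] }
  map_one' := LinearMap.ext fun w => by simp [Function.surjInv_eq hT]
  map_mul' g h := LinearMap.ext fun w => by
    simp [apply_surjInv_of_ker_le T hT (ρ g) (hρ g)]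

theorem descendRep_apply {V W : Type*} [AddCommGroup V] [Module k V] [AddCommGroup W]
    [Module k W] (ρ : Representation k G V) (T : V →ₗ[k] W) (hT : Function.Surjective T)
    (hρ : ∀ g v, T v = 0 → T (ρ g v) = 0) (g : G) (v : V) :
    descendRep ρ T hT hρ g (T v) = T (ρ g v) :=
  apply_surjInv_of_ker_le T hT (ρ g) (hρ g) v

variable {ι : Type} (φ : G →* Multiplicative (ι → k))

/-- The representation of `G` on functions `(ι → k) → k` by translation through `φ`. When `φ` is
surjective with kernel `K`, this is the permutation module of `G ⧸ K`. -/
noncomputable def functionRep : Representation k G ((ι → k) → k) where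
  toFun g := shift k ι (φ g).toAdd
  map_one' := by
    ext f e
    simp
  map_mul' g h := by
    refine LinearMap.ext fun f => funext fun e => ?_
    simp [add_assoc]

variable [Fintype k] [Fintype ι] [DecidableEq ι]

/-- The quotient of `functionRep φ` by the functions with vanishing moments of degree less than `m`,
realized on the space of these moments. -/
noncomputable def momentRep (m : ℕ) :
    Representation k G ({I : Finset ι // I.card < m} → k) :=
  descendRep (functionRep φ) (moments k ι m) (moments_surjective m)
    fun g f hf => moments_shift_eq_zero m (φ g).toAdd f hf

theorem momentRep_moments (m : ℕ) (g : G) (f : (ι → k) → k) :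
    momentRep φ m g (moments k ι m f) = moments k ι m (shift k ι (φ g).toAdd f) :=
  descendRep_apply _ _ _ _ _ _

/-- The functions whose moments of degree less than `m` vanish. -/
noncomputable def momentKer (m : ℕ) : Subrepresentation (functionRep φ) where
  toSubmodule := LinearMap.ker (moments k ι m)
  apply_mem_toSubmodule g f hf := moments_shift_eq_zero m (φ g).toAdd f hf

end Representations

/-! ### Counting subsets by size -/

section Counting

variable {ι : Type} [Fintype ι]

theorem card_card_lt_succ (m : ℕ) :
    Fintype.card {I : Finset ι // I.card < m + 1} =
      Fintype.card {I : Finset ι // I.card < m} + Fintype.card {I : Finset ι // I.card = m} := by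
  rw [← Fintype.card_subtype_or_disjoint]
  · exact Fintype.card_congr (Equiv.subtypeEquivRight fun I => by omega)
  · rw [Pi.disjoint_iff]
    intro I
    rw [Prop.disjoint_iff]
    omega

theorem card_card_lt (m : ℕ) :
    Fintype.card {I : Finset ι // I.card < m} =
      ∑ r ∈ Finset.range m, (Fintype.card ι).choose r := by
  induction m with
  | zero => simp
  | succ m ih =>
    rw [card_card_lt_succ, ih, Finset.sum_range_succ, Fintype.card_finset_len]

end Counting

/-! ### Homology of the moment representations -/

section Filtration

open CategoryTheory groupHomology

variable {k G : Type u} [Field k] [Group G] [Fintype k] {ι : Type} [Fintype ι] [DecidableEq ι]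
  (φ : G →* Multiplicative (ι → k))

/-- Forgetting the moments of degree `m`. -/
noncomputable def truncation (m : ℕ) :
    Rep.of (momentRep φ (m + 1)) ⟶ Rep.of (momentRep φ m) :=
  Rep.ofHom ⟨LinearMap.funLeft k k fun I => ⟨I.1, I.2.trans_le m.le_succ⟩, fun g => by
    refine LinearMap.ext fun v => ?_
    obtain ⟨f, rfl⟩ := moments_surjective (m + 1) v
    change LinearMap.funLeft k k _ (momentRep φ (m + 1) g _) =
      momentRep φ m g (moments k ι m f)
    rw [momentRep_moments, momentRep_moments]
    rfl⟩

/-- The moments of degree `m`, extended by zero to degrees less than `m`. The action on them is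
trivial because translation changes a moment only by moments of lower degree. -/
noncomputable def topDegree (m : ℕ) :
    Rep.trivial k G ({I : Finset ι // I.card = m} → k) ⟶ Rep.of (momentRep φ (m + 1)) :=
  Rep.ofHom ⟨{
      toFun := fun w I => if h : I.1.card = m then w ⟨I.1, h⟩ else 0
      map_add' := fun v w => by
        ext I
        by_cases h : I.1.card = m <;> simp [h]
      map_smul' := fun a w => by
        ext I
        by_cases h : I.1.card = m <;> simp [h] }, fun g => by
    refine LinearMap.ext fun w => ?_
    simp only [LinearMap.comp_apply]
    change _ = momentRep φ (m + 1) g _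
    obtain ⟨f, hf⟩ := moments_surjective (m + 1)
      (fun I : {I : Finset ι // I.card < m + 1} => if h : I.1.card = m then w ⟨I.1, h⟩ else 0)
    change (fun I : {I : Finset ι // I.card < m + 1} =>
      if h : I.1.card = m then w ⟨I.1, h⟩ else 0) = momentRep φ (m + 1) g
        (fun I : {I : Finset ι // I.card < m + 1} =>
          if h : I.1.card = m then w ⟨I.1, h⟩ else 0)
    rw [← hf, momentRep_moments]
    funext I
    refine (moments_shift_apply_eq (m + 1) _ f I fun S hS => ?_).symm
    have h1 := Finset.card_lt_card hS
    have h2 := I.2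
    rw [hf]
    exact dif_neg (by omega)⟩

theorem exists_shortExact_truncation (m : ℕ) :
    ∃ w : topDegree φ m ≫ truncation φ m = 0,
      (ShortComplex.mk (topDegree φ m) (truncation φ m) w).ShortExact := by
  refine shortExact_of_range_eq_ker _ _ ?_ ?_ ?_
  · intro v w h
    funext I
    have h1 := congrFun h ⟨I.1, I.2.trans_lt m.lt_succ_self⟩
    change (if h : I.1.card = m then v ⟨I.1, h⟩ else 0) =
      (if h : I.1.card = m then w ⟨I.1, h⟩ else 0) at h1
    rwa [dif_pos I.2, dif_pos I.2] at h1
  · exact LinearMap.funLeft_surjective_of_injective k k _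
      fun I J h => Subtype.ext (congrArg (fun K => K.1) h)
  · refine le_antisymm ?_ ?_
    · rintro _ ⟨w, rfl⟩
      rw [LinearMap.mem_ker]
      funext I
      exact dif_neg I.2.ne
    · intro v hv
      refine ⟨fun I => v ⟨I.1, I.2.trans_lt m.lt_succ_self⟩, funext fun I => ?_⟩
      by_cases h : I.1.card = m
      · exact dif_pos h
      · have h1 := congrFun (LinearMap.mem_ker.1 hv) ⟨I.1, by have := I.2; omega⟩
        exact (dif_neg h).trans h1.symm

theorem momentRep_apply_empty (m : ℕ) (g : G) (v : {I : Finset ι // I.card < m + 1} → k) :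
    momentRep φ (m + 1) g v ⟨∅, m.succ_pos⟩ = v ⟨∅, m.succ_pos⟩ := by
  obtain ⟨f, rfl⟩ := moments_surjective (m + 1) v
  rw [momentRep_moments]
  exact moments_shift_apply_eq _ _ _ _ fun S hS => absurd hS (Finset.not_ssubset_empty _)

/-- The moment of degree zero. -/
noncomputable def constantTerm (m : ℕ) :
    Rep.of (momentRep φ (m + 1)) ⟶ Rep.trivial k G k :=
  Rep.ofHom ⟨LinearMap.proj (R := k) (φ := fun _ => k)
      (⟨∅, m.succ_pos⟩ : {I : Finset ι // I.card < m + 1}), fun g =>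
    LinearMap.ext fun v => momentRep_apply_empty φ m g v⟩

theorem one_le_homDim_momentRep (m : ℕ) : 1 ≤ homDim (Rep.of (momentRep φ (m + 1))) 0 := by
  have hf : Epi (constantTerm φ m) := (Rep.epi_iff_surjective _).2 fun x => ⟨fun _ => x, rfl⟩
  have : Module.Finite k (Rep.of (momentRep φ (m + 1))) :=
    inferInstanceAs (Module.Finite k ({I : Finset ι // I.card < m + 1} → k))
  have := finite_homology_zero (Rep.of (momentRep φ (m + 1)))
  exact (homDim_trivial_zero (k := k) (G := G)).symm.trans_le
    (homDim_zero_le_of_epi (constantTerm φ m))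

variable [Module.Finite k (groupHomology (Rep.trivial k G k) 1)]
  [Module.Finite k (groupHomology (Rep.trivial k G k) 2)]

theorem finite_homology_momentRep (m : ℕ) :
    Module.Finite k (groupHomology (Rep.of (momentRep φ m)) 1) ∧
      Module.Finite k (groupHomology (Rep.of (momentRep φ m)) 2) := by
  induction m with
  | zero =>
    have : IsEmpty {I : Finset ι // I.card < 0} := ⟨fun I => by simpa using I.2⟩
    have : Subsingleton (Rep.of (momentRep φ 0)) :=
      inferInstanceAs (Subsingleton ({I : Finset ι // I.card < 0} → k))
    exact ⟨(homDim_zeroModule _ 1).2, (homDim_zeroModule _ 2).2⟩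
  | succ m ih =>
    obtain ⟨w, hX⟩ := exists_shortExact_truncation φ m
    have := ih.1
    have := ih.2
    have := finite_homology_trivial_pi (k := k) (G := G) {I : Finset ι // I.card = m} 1
    have := finite_homology_trivial_pi (k := k) (G := G) {I : Finset ι // I.card = m} 2
    exact ⟨finite_homology_middle hX 1, finite_homology_middle hX 2⟩

/-- The count in `homDim_two_and_one_add_zero` for `0 → k^(n choose m) → N_(m+1) → N_m → 0`, where
`N_m` is the representation on moments of degree less than `m`. -/
theorem exists_homDim_momentRep_succ (m : ℕ) :
    ∃ c : ℕ, c ≤ homDim (Rep.of (momentRep φ m)) 2 ∧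
      homDim (Rep.of (momentRep φ (m + 1))) 2 + c ≤
        (Fintype.card ι).choose m * homDim (Rep.trivial k G k) 2 +
          homDim (Rep.of (momentRep φ m)) 2 ∧
      homDim (Rep.of (momentRep φ (m + 1))) 1 + (Fintype.card ι).choose m +
          homDim (Rep.of (momentRep φ m)) 0 + c =
        (Fintype.card ι).choose m * homDim (Rep.trivial k G k) 1 +
          homDim (Rep.of (momentRep φ m)) 1 + homDim (Rep.of (momentRep φ (m + 1))) 0 := by
  obtain ⟨w, hX⟩ := exists_shortExact_truncation φ m
  have := (finite_homology_momentRep φ m).1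
  have := (finite_homology_momentRep φ m).2
  have : Module.Finite k (Rep.of (momentRep φ m)) :=
    inferInstanceAs (Module.Finite k ({I : Finset ι // I.card < m} → k))
  have := finite_homology_zero (Rep.of (momentRep φ m))
  have : Module.Finite k (Rep.trivial k G k) := inferInstanceAs (Module.Finite k k)
  have := finite_homology_zero (Rep.trivial k G k)
  have := finite_homology_trivial_pi (k := k) (G := G) {I : Finset ι // I.card = m} 0
  have := finite_homology_trivial_pi (k := k) (G := G) {I : Finset ι // I.card = m} 1
  have := finite_homology_trivial_pi (k := k) (G := G) {I : Finset ι // I.card = m} 2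
  have h := homDim_two_and_one_add_zero hX
  simp only [homDim_trivial_pi, Fintype.card_finset_len, homDim_trivial_zero, mul_one] at h
  exact h

/-- Superadditivity of `dim H_1 - dim H_0 - dim H_2` along the filtration by degree. -/
theorem euler_le_homDim_momentRep (m : ℕ) :
    homDim (Rep.of (momentRep φ m)) 0 + homDim (Rep.of (momentRep φ m)) 2 +
        (∑ r ∈ Finset.range m, (Fintype.card ι).choose r) * homDim (Rep.trivial k G k) 1 ≤
      homDim (Rep.of (momentRep φ m)) 1 +
        (∑ r ∈ Finset.range m, (Fintype.card ι).choose r) *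
          (1 + homDim (Rep.trivial k G k) 2) := by
  induction m with
  | zero =>
    have : IsEmpty {I : Finset ι // I.card < 0} := ⟨fun I => by simpa using I.2⟩
    have : Subsingleton (Rep.of (momentRep φ 0)) :=
      inferInstanceAs (Subsingleton ({I : Finset ι // I.card < 0} → k))
    simp [(homDim_zeroModule (Rep.of (momentRep φ 0)) 0).1,
      (homDim_zeroModule (Rep.of (momentRep φ 0)) 2).1]
  | succ m ih =>
    obtain ⟨c, -, h1, h2⟩ := exists_homDim_momentRep_succ φ m
    rw [Finset.sum_range_succ, add_mul, add_mul, mul_add _ 1]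
    linarith

/-- The bound on `H_1` of the moments of degree at most `m`. Only the steps of degree less than `m`
contribute an `H_2` term: at the last step the rank of the connecting map is at most the dimension
of `H_2` of the preceding moment representation. -/
theorem le_homDim_one_momentRep_succ (m : ℕ) :
    1 + (∑ r ∈ Finset.range (m + 1), (Fintype.card ι).choose r) *
        homDim (Rep.trivial k G k) 1 ≤
      homDim (Rep.of (momentRep φ (m + 1))) 1 +
        (∑ r ∈ Finset.range (m + 1), (Fintype.card ι).choose r) +
        (∑ r ∈ Finset.range m, (Fintype.card ι).choose r) * homDim (Rep.trivial k G k) 2 := by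
  obtain ⟨c, h1, -, h2⟩ := exists_homDim_momentRep_succ φ m
  have h3 := euler_le_homDim_momentRep φ m
  have h4 := one_le_homDim_momentRep φ m
  rw [Finset.sum_range_succ, add_mul]
  rw [mul_add] at h3
  linarith

end Filtration

/-! ### Coinvariants of the functions with vanishing moments -/

section Kernel

open CategoryTheory groupHomology

variable {k G : Type u} [Field k] [Group G] [Fintype k] {ι : Type} [Fintype ι] [DecidableEq ι]
  (φ : G →* Multiplicative (ι → k))

/-- The inclusion of the functions with vanishing moments into all functions. -/
noncomputable def momentKerInclusion (m : ℕ) :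
    Rep.of (momentKer φ m).toRepresentation ⟶ Rep.of (functionRep φ) :=
  Rep.ofHom ⟨(momentKer φ m).toSubmodule.subtype, fun _ => rfl⟩

/-- The moments as a map of representations. -/
noncomputable def momentsHom (m : ℕ) :
    Rep.of (functionRep φ) ⟶ Rep.of (momentRep φ m) :=
  Rep.ofHom ⟨moments k ι m, fun g => LinearMap.ext fun f => (momentRep_moments φ m g f).symm⟩

theorem exists_shortExact_moments (m : ℕ) :
    ∃ w : momentKerInclusion φ m ≫ momentsHom φ m = 0,
      (ShortComplex.mk (momentKerInclusion φ m) (momentsHom φ m) w).ShortExact :=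
  shortExact_of_range_eq_ker _ _ Subtype.val_injective (moments_surjective m)
    (Submodule.range_subtype _)

/-- The pairing `(h, f) ↦ ∑_e f(e) h(e)` of functions, as a map to the dual of a subspace. -/
noncomputable def pairing (V : Submodule k ((ι → k) → k)) :
    ((ι → k) → k) →ₗ[k] Module.Dual k V :=
  LinearMap.mk₂ k (fun (h : (ι → k) → k) (f : V) => ∑ e, f.1 e * h e)
    (fun _ _ _ => by simp [mul_add, Finset.sum_add_distrib])
    (fun _ _ _ => by simp [Finset.mul_sum, mul_left_comm])
    (fun _ _ _ => by simp [add_mul, Finset.sum_add_distrib])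
    (fun _ _ _ => by simp [Finset.mul_sum, mul_assoc])

theorem pairing_apply (V : Submodule k ((ι → k) → k)) (h : (ι → k) → k) (f : V) :
    pairing V h f = ∑ e, f.1 e * h e := rfl

theorem pairing_surjective (V : Submodule k ((ι → k) → k)) :
    Function.Surjective (pairing V) := by
  classical
  intro l
  obtain ⟨L, hL⟩ := LinearMap.exists_extend l
  refine ⟨fun e => L (Pi.single e 1), LinearMap.ext fun f => ?_⟩
  rw [pairing_apply, ← hL, LinearMap.comp_apply]
  conv_rhs => rw [Submodule.subtype_apply, ← Finset.univ_sum_single f.1, map_sum]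
  refine Finset.sum_congr rfl fun e _ => ?_
  rw [← smul_eq_mul, ← map_smul, ← Pi.single_smul, smul_eq_mul, mul_one]

theorem sum_shift_mul (a : ι → k) (f h : (ι → k) → k) :
    ∑ e, shift k ι (-a) f e * h e = ∑ e, f e * shift k ι a h e :=
  Fintype.sum_equiv (Equiv.addRight (-a)) _ _ fun e => by simp

/-- A functional on the coinvariants of `momentKer` is pairing with a function `h` whose differences
are orthogonal to `momentKer`, that is, with squarefree differences of degree less than `m`; and
squarefree `h` of degree less than `m` give the zero functional. -/
theorem homDim_zero_momentKer_add_card_le (hφ : Function.Surjective φ) (m : ℕ) :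
    homDim (Rep.of (momentKer φ m).toRepresentation) 0 +
        Fintype.card {I : Finset ι // I.card < m} ≤
      Module.finrank k (differencesIn (LinearMap.range (squareFreePoly k ι m))) := by
  set M := LinearMap.range (squareFreePoly k ι m) with hM
  set ρ := (momentKer φ m).toRepresentation
  let Φ := pairing (momentKer φ m).toSubmodule
  have hMle : M ≤ differencesIn M := by
    intro h hh
    rw [mem_differencesIn]
    intro a
    refine mem_range_squareFreePoly_of_ker m _ fun f hf => ?_
    simp only [Pi.sub_apply, mul_sub, Finset.sum_sub_distrib]
    rw [← sum_shift_mul, sum_mul_squareFreePoly_of_moments_eq_zero m f hf hh,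
      sum_mul_squareFreePoly_of_moments_eq_zero m _ (moments_shift_eq_zero m _ f hf) hh, sub_zero]
  have hMcard : Module.finrank k M = Fintype.card {I : Finset ι // I.card < m} := by
    rw [hM, LinearMap.finrank_range_of_inj (squareFreePoly_injective m),
      Module.finrank_fintype_fun_eq_card]
  -- invariant functionals on the kernel are represented by elements of `differencesIn M`
  have hrange : LinearMap.range (Representation.Coinvariants.mk ρ).dualMap ≤
      (differencesIn M).map Φ := by
    rintro _ ⟨l, rfl⟩
    obtain ⟨h, hh⟩ := pairing_surjective (momentKer φ m).toSubmodule
      ((Representation.Coinvariants.mk ρ).dualMap l)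
    refine ⟨h, ?_, hh⟩
    rw [SetLike.mem_coe, mem_differencesIn]
    intro a
    refine mem_range_squareFreePoly_of_ker m _ fun f hf => ?_
    obtain ⟨g, hg⟩ := hφ (Multiplicative.ofAdd (-a))
    have h1 : ρ g ⟨f, hf⟩ - ⟨f, hf⟩ ∈ Representation.Coinvariants.ker ρ :=
      Representation.Coinvariants.sub_mem_ker _ _
    rw [← Representation.Coinvariants.mk_eq_zero] at h1
    have h2 := DFunLike.congr_fun hh (ρ g ⟨f, hf⟩ - ⟨f, hf⟩)
    rw [LinearMap.dualMap_apply, h1, map_zero, map_sub, pairing_apply, pairing_apply] at h2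
    have h3 : (ρ g ⟨f, hf⟩).1 = shift k ι (-a) f := by
      change shift k ι (φ g).toAdd f = _
      rw [hg]
      rfl
    rw [h3, sum_shift_mul] at h2
    simpa only [Pi.sub_apply, mul_sub, Finset.sum_sub_distrib] using h2
  have h1 := Submodule.finrank_mono hrange
  have hinj : Function.Injective (Representation.Coinvariants.mk ρ).dualMap :=
    LinearMap.dualMap_injective_iff.2 (Representation.Coinvariants.mk_surjective ρ)
  rw [LinearMap.finrank_range_of_inj hinj, Subspace.dual_finrank_eq] at h1
  have h2 := LinearMap.finrank_range_add_finrank_ker (Φ.domRestrict (differencesIn M))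
  rw [LinearMap.range_domRestrict] at h2
  have h3 : Module.finrank k M ≤
      Module.finrank k (LinearMap.ker (Φ.domRestrict (differencesIn M))) := by
    refine LinearMap.finrank_le_finrank_of_injective
      (f := (Submodule.inclusion hMle).codRestrict _ ?_) ?_
    · intro h
      rw [LinearMap.mem_ker]
      exact LinearMap.ext fun f => sum_mul_squareFreePoly_of_moments_eq_zero m f.1 f.2 h.2
    · intro x y hxy
      exact Subtype.ext (congrArg (fun z => z.1.1) hxy)
  rw [homDim_zero_eq, ← hMcard]
  change Module.finrank k ρ.Coinvariants + _ ≤ _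
  omega

end Kernel

/-! ### Shapiro's lemma and the bound for prime fields -/

section Shapiro

open CategoryTheory groupHomology

variable {k G : Type u} [Field k] [Group G] {ι : Type} (φ : G →* Multiplicative (ι → k))

/-- Shapiro's lemma: `functionRep φ` is coinduced from the trivial representation of the kernel of
`φ`, and for finite index coinduction agrees with induction. -/
theorem nonempty_homology_functionRep_equiv (hφ : Function.Surjective φ)
    (K : Subgroup G) [K.FiniteIndex] (hK : ∀ g, g ∈ K ↔ φ g = 1) (r : ℕ) :
    Nonempty (groupHomology (Rep.of (functionRep φ)) r ≃ₗ[k]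
      groupHomology (Rep.trivial k K k) r) := by
  classical
  let f : ((ι → k) → k) →ₗ[k] Representation.coindV K.subtype (Representation.trivial k K k) :=
    { toFun := fun f => ⟨fun g => f (φ g).toAdd, fun s g => by
        have := (hK s.1).1 s.2
        simp [this]⟩
      map_add' := fun _ _ => rfl
      map_smul' := fun _ _ => rfl }
  have hf : Function.Bijective f := by
    constructor
    · intro a b hab
      funext e
      obtain ⟨g, hg⟩ := hφ (Multiplicative.ofAdd e)
      have := congrFun (Subtype.ext_iff.1 hab) g
      change a (φ g).toAdd = b (φ g).toAdd at this
      rwa [hg] at this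
    · intro b
      refine ⟨fun e => b.1 (Function.surjInv hφ (Multiplicative.ofAdd e)),
        Subtype.ext (funext fun g => ?_)⟩
      change b.1 (Function.surjInv hφ (φ g)) = b.1 g
      have hs : Function.surjInv hφ (φ g) * g⁻¹ ∈ K := by
        rw [hK, map_mul, map_inv, Function.surjInv_eq hφ, mul_inv_cancel]
      have := b.2 ⟨_, hs⟩ g
      simpa using this
  have e : Rep.of (functionRep φ) ≅ Rep.coind K.subtype (Rep.trivial k K k) :=
    Rep.mkIso (.mk (LinearEquiv.ofBijective f hf) fun g => by
      refine LinearMap.ext fun a => Subtype.ext (funext fun h => ?_)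
      change a ((φ h).toAdd + (φ g).toAdd) = a (φ (h * g)).toAdd
      rw [map_mul, toAdd_mul])
  exact ⟨((functor k G r).mapIso (e ≪≫ (Rep.indCoindIso (Rep.trivial k K k)).symm) ≪≫
    indIso K (Rep.trivial k K k) r).toLinearEquiv⟩

end Shapiro

section Bound

open CategoryTheory groupHomology

variable {k G : Type u} [Field k] [Group G] [Group.FG G] [Fintype k] {ι : Type} [Fintype ι]

theorem homDim_one_momentRep_le [DecidableEq ι]
    [Module.Finite k (groupHomology (Rep.trivial k G k) 2)]
    (φ : G →* Multiplicative (ι → k)) (hφ : Function.Surjective φ) (K : Subgroup G)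
    [K.FiniteIndex] (hK : ∀ g, g ∈ K ↔ φ g = 1) (m : ℕ) :
    homDim (Rep.of (momentRep φ m)) 1 ≤ homDim (Rep.trivial k K k) 1 +
      homDim (Rep.of (momentKer φ m).toRepresentation) 0 := by
  have := finite_homology_one (k := k) (G := G)
  have := finite_homology_one (k := k) (G := K)
  obtain ⟨s⟩ := nonempty_homology_functionRep_equiv φ hφ K hK 1
  obtain ⟨w, hX⟩ := exists_shortExact_moments φ m
  have : Module.Finite k (groupHomology (Rep.of (momentRep φ m)) 1) :=
    (finite_homology_momentRep φ m).1
  have : Module.Finite k (groupHomology (Rep.of (functionRep φ)) 1) := Module.Finite.equiv s.symm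
  have : Module.Finite k (Rep.of (momentKer φ m).toRepresentation) :=
    inferInstanceAs (Module.Finite k (momentKer φ m).toSubmodule)
  have := finite_homology_zero (Rep.of (momentKer φ m).toRepresentation)
  have hs : homDim (Rep.of (functionRep φ)) 1 = homDim (Rep.trivial k K k) 1 := s.finrank_eq
  have h := homDim_one_le hX
  exact h.trans_eq (congrArg (· + _) hs)

/-- The main inequality. The number `d` is an excess in the count of functions with squarefree
differences: `0` in characteristic 2 or for `ℓ = 0`, and the rank `n` otherwise. -/
theorem homDim_one_subgroup_bound [DecidableEq ι]
    [Module.Finite k (groupHomology (Rep.trivial k G k) 2)]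
    (φ : G →* Multiplicative (ι → k)) (hφ : Function.Surjective φ) (K : Subgroup G)
    [K.FiniteIndex] (hK : ∀ g, g ∈ K ↔ φ g = 1) (ℓ d : ℕ)
    (hd : Module.finrank k (differencesIn (LinearMap.range (squareFreePoly k ι (ℓ + 1)))) ≤
      Fintype.card {S : Finset ι // S.card < ℓ + 2} + d) :
    1 + (∑ r ∈ Finset.range (ℓ + 1), (Fintype.card ι).choose r) *
        homDim (Rep.trivial k G k) 1 ≤
      homDim (Rep.trivial k K k) 1 +
        (∑ r ∈ Finset.range (ℓ + 2), (Fintype.card ι).choose r) + d +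
        (∑ r ∈ Finset.range ℓ, (Fintype.card ι).choose r) * homDim (Rep.trivial k G k) 2 := by
  have := finite_homology_one (k := k) (G := G)
  have h1 := le_homDim_one_momentRep_succ φ ℓ
  have h2 := homDim_zero_momentKer_add_card_le φ hφ (ℓ + 1)
  have h3 := homDim_one_momentRep_le φ hφ K hK (ℓ + 1)
  rw [card_card_lt] at h2 hd
  linarith

end Bound

/-! ### Binomial sums and conclusion -/

section Binomial

theorem sum_choose_Icc_one (n ℓ : ℕ) :
    ∑ r ∈ Finset.range (ℓ + 2), (n.choose r : ℤ) =
      1 + ∑ r ∈ Finset.Icc 1 (ℓ + 1), (n.choose r : ℤ) := by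
  rw [Finset.sum_range_eq_add_Ico _ (by omega), Nat.choose_zero_right, Nat.cast_one]
  rfl

/-- The comparison of `homDim_one_subgroup_bound` with the bound for general `p`; in the inductive
step it rests on `(ℓ + 2) * choose n (ℓ + 2) = (n - ℓ - 1) * choose n (ℓ + 1)`. -/
theorem sum_choose_mul_add_sum_choose_le (n ℓ : ℕ) :
    ∑ r ∈ Finset.Icc 2 (ℓ + 1), (n.choose r : ℤ) * ((r : ℤ) - 1) +
        ∑ r ∈ Finset.range (ℓ + 2), (n.choose r : ℤ) + (if ℓ = 0 then 0 else (n : ℤ)) ≤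
      n * ∑ r ∈ Finset.range (ℓ + 1), (n.choose r : ℤ) + 1 := by
  have hstep : ∀ j : ℕ, (n.choose (j + 1) : ℤ) * ((j : ℤ) + 1) = n.choose j * (n - j) := by
    intro j
    have h := Nat.choose_succ_right_eq n j
    rcases le_or_gt j n with hj | hj
    · have h2 : ((n - j : ℕ) : ℤ) = n - j := by push_cast [hj]; ring
      rw [← h2]
      exact_mod_cast h
    · rw [Nat.choose_eq_zero_of_lt hj, Nat.choose_eq_zero_of_lt (by omega : n < j + 1)]
      simp
  induction ℓ with
  | zero => simp [Finset.sum_range_succ, add_comm]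
  | succ ℓ ih =>
    rw [Finset.sum_Icc_succ_top (by omega), Finset.sum_range_succ _ (ℓ + 2),
      Finset.sum_range_succ _ (ℓ + 1), if_neg ℓ.succ_ne_zero]
    have h1 := hstep (ℓ + 1)
    have h2 : (0 : ℤ) ≤ n.choose (ℓ + 1) := by positivity
    have h3 : (0 : ℤ) ≤ n.choose (ℓ + 1) * ℓ := by positivity
    push_cast at h1 ⊢
    rcases Nat.eq_zero_or_pos ℓ with h0 | h0
    · subst h0
      simp at h1 ⊢
      nlinarith
    · rw [if_neg h0.ne', Finset.sum_range_succ _ (ℓ + 1)] at ih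
      linarith

end Binomial

theorem theorem1p6 (G : Type u) [Group G] [Group.FG G] (p : ℕ) [Fact p.Prime]
    (hb : Module.Finite (LiftedFp.{u} p) (modPHomology p G 2))
    (K : Subgroup G) [K.Normal] [K.FiniteIndex] (n : ℕ)
    (hK : IsElementaryAbelianOfRank p n (G ⧸ K)) (ℓ : ℕ) (hℓ : ℓ ≤ n) :
    ((modPBetti p K 1 : ℤ) ≥
      ∑ r ∈ Finset.Icc 2 (ℓ + 1), (n.choose r : ℤ) * ((r : ℤ) - 1)
        + ((modPBetti p G 1 : ℤ) - (n : ℤ)) * ∑ r ∈ Finset.range (ℓ + 1), (n.choose r : ℤ)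
        - (modPBetti p G 2 : ℤ) * ∑ r ∈ Finset.range ℓ, (n.choose r : ℤ)) ∧
    (p = 2 →
      (modPBetti p K 1 : ℤ) ≥
        (modPBetti p G 1 : ℤ) * ∑ r ∈ Finset.range (ℓ + 1), (n.choose r : ℤ)
          - ∑ r ∈ Finset.Icc 1 (ℓ + 1), (n.choose r : ℤ)
          - (modPBetti p G 2 : ℤ) * ∑ r ∈ Finset.range ℓ, (n.choose r : ℤ)) := by
  obtain ⟨e⟩ := hK
  have : Fintype (LiftedFp.{u} p) := Fintype.ofEquiv (ZMod p) Equiv.ulift.symm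
  have hk : ∀ c : LiftedFp.{u} p, ∃ m : ℕ, (m : LiftedFp.{u} p) = c := fun c =>
    ⟨c.down.val, ULift.ext _ _ (ZMod.natCast_zmod_val c.down)⟩
  let e' : (Fin n → ZMod p) ≃+ (Fin n → LiftedFp.{u} p) :=
    AddEquiv.piCongrRight fun _ => AddEquiv.ulift.symm
  let φ : G →* Multiplicative (Fin n → LiftedFp.{u} p) :=
    (AddEquiv.toMultiplicative e').toMonoidHom.comp (e.toMonoidHom.comp (QuotientGroup.mk' K))
  have hφ : Function.Surjective φ :=
    (AddEquiv.toMultiplicative e').surjective.comp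
      (e.surjective.comp (QuotientGroup.mk'_surjective K))
  have hker : ∀ g, g ∈ K ↔ φ g = 1 := fun g => by
    simp [φ]
  have key := fun d hd => homDim_one_subgroup_bound (k := LiftedFp.{u} p) φ hφ K hker ℓ d hd
  simp only [Fintype.card_fin] at key
  have key' : ∀ d : ℕ, _ → (1 : ℤ) + (∑ r ∈ Finset.range (ℓ + 1), (n.choose r : ℤ)) *
      modPBetti p G 1 ≤ modPBetti p K 1 + (∑ r ∈ Finset.range (ℓ + 2), (n.choose r : ℤ)) + d +
        (∑ r ∈ Finset.range ℓ, (n.choose r : ℤ)) * modPBetti p G 2 :=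
    fun d hd => by exact_mod_cast key d hd
  constructor
  · have h1 := sum_choose_mul_add_sum_choose_le n ℓ
    split_ifs at h1 with h0
    · have h2 := key' 0 (finrank_differencesIn_le_of hk (ℓ + 1) (Or.inl (by omega)))
      push_cast at h2
      linarith
    · have h2 := key' n ((finrank_differencesIn_le hk (ℓ + 1)).trans_eq (by rw [Fintype.card_fin]))
      linarith
  · intro hp
    subst hp
    have h1 := sum_choose_Icc_one n ℓ
    have h2 := key' 0 (finrank_differencesIn_le_of hk (ℓ + 1)
      (Or.inr (ULift.ext _ _ (CharTwo.two_eq_zero (R := ZMod 2)))))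
    push_cast at h2
    linarith
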